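/- For every $\epsilon>0$ and every $c>0$ there is an $n_0=n_0(\epsilon,c)$ such that the following holds. Let $G=(V,E)$ be a finite simple graph with $n=|V|\ge n_0$ vertices and maximum degree $\Delta$, and let $\rho$ be the operator norm (equivalently, the largest eigenvalue) of its adjacency matrix. Suppose that $\rho\le\Delta^{1-\epsilon}$ and $\Delta\ge c\,(\ln n)^{1+\epsilon}$, and let $k$ be an integer with $k>4\epsilon^{-1}\Delta/\ln\Delta$. Then the set $\Omega$ of proper colorings $Y:V\to\{1,\dots,k\}$ of $G$ is non-empty, and if $Y$ is chosen uniformly at random from $\Omega$, then $$\Pr\left[\exists v\in V:\ a_Y(v)<\Delta^{1-\epsilon/2}\right]\le n^{-4},$$ where $a_Y(v)=|\{1,\dots,k\}\setminus Y(N(v))|$ is the number of colors available at $v$, that is, the colors that $Y$ uses on no neighbor of $v$. -/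

import Mathlib

namespace UniformColoring

variable {V : Type*} [Fintype V] [DecidableEq V]

/-- The operator norm of the adjacency matrix of `G`, acting on `ℝ^V` with the Euclidean norm. -/
noncomputable def operatorNorm (G : SimpleGraph V) [DecidableRel G.Adj] : ℝ :=
  ‖Matrix.toEuclideanCLM (n := V) (𝕜 := ℝ) (G.adjMatrix ℝ)‖

/-- The set of all proper `k`-colorings of `G`. -/
def properColorings {V : Type*} (G : SimpleGraph V) (k : ℕ) : Set (V → Fin k) :=
  {Y | ∀ u v : V, G.Adj u v → Y u ≠ Y v}

/-- The colors available for `v` under `Y`: those not used by `Y` on the neighbors of `v`. -/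
def availableColors {V : Type*} [Fintype V] (G : SimpleGraph V) [DecidableRel G.Adj] {k : ℕ}
    (Y : V → Fin k) (v : V) : Finset (Fin k) :=
  Finset.univ \ (G.neighborFinset v).image Y

end UniformColoring

/-! Write ρ for the operator norm and T = Δ^(1-ε/2); call a vertex bad if fewer than T colors are
available at it. Since ρ bounds the average degree of every induced subgraph, a nonempty set of bad
vertices contains some v with at most ρ bad neighbors. It therefore suffices to rule out, with high
probability and for each fixed v, being bad with so few bad neighbors, and then to take a union
bound over v.

Fix v and let R be its neighbors having at most T/32 common neighbors with v; the mixing bound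
leaves few neighbors outside R. Call u ∈ R active if at least T colors are free of its neighbors
outside R. This property depends only on colors outside R, and an active u has available at least
31/32 of those colors, however R is colored. Resampling the vertices of R one by one preserves the
uniform measure, and `unusedPotential` does not decrease in conditional mean at each step. An
exponential moment bound (`sum_exp_card_unusedColors_le`) then shows that at least m/2 colors stay
unused by active vertices, except with probability exp(-m²/(32Δ)), where m = Δ^(1-3ε/10). A bad v
with at most ρ bad neighbors would leave fewer (`card_unusedColors_lt`). -/

namespace UniformColoring

open Finset

/-! ### Edge counts and degeneracy from the operator norm. -/

section Spectral

variable {V : Type*} [Fintype V] [DecidableEq V] (G : SimpleGraph V) [DecidableRel G.Adj]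

theorem norm_indicator (S : Finset V) :
    ‖WithLp.toLp 2 (fun i => if i ∈ S then (1 : ℝ) else 0)‖ = √(#S : ℝ) := by
  rw [EuclideanSpace.norm_eq]
  congr 1
  simp [apply_ite, Finset.sum_ite_mem]

/-- Pair the indicator of S with the adjacency matrix applied to the indicator of T and use
Cauchy–Schwarz. -/
theorem sum_card_neighborFinset_inter_le (S T : Finset V) :
    ∑ u ∈ S, (#(G.neighborFinset u ∩ T) : ℝ) ≤ operatorNorm G * (√(#S : ℝ) * √(#T : ℝ)) := by
  set x : EuclideanSpace ℝ V := WithLp.toLp 2 (fun i => if i ∈ S then (1 : ℝ) else 0) with hx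
  set y : EuclideanSpace ℝ V := WithLp.toLp 2 (fun i => if i ∈ T then (1 : ℝ) else 0) with hy
  set A := Matrix.toEuclideanCLM (n := V) (𝕜 := ℝ) (G.adjMatrix ℝ) with hA
  have hAy (u : V) : (A y) u = #(G.neighborFinset u ∩ T) := by
    simp [hA, hy, Finset.sum_ite_mem]
  have h1 : inner ℝ x (A y) = ∑ u ∈ S, (#(G.neighborFinset u ∩ T) : ℝ) := by
    rw [PiLp.inner_apply]
    simp [hAy, hx, Finset.sum_ite_mem]
  calc _ = inner ℝ x (A y) := h1.symm
    _ ≤ ‖x‖ * ‖A y‖ := real_inner_le_norm _ _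
    _ ≤ ‖x‖ * (‖A‖ * ‖y‖) := by gcongr; exact A.le_opNorm y
    _ = _ := by rw [hx, hy, norm_indicator, norm_indicator, operatorNorm]; ring

theorem operatorNorm_nonneg : 0 ≤ operatorNorm G := norm_nonneg _

theorem sqrt_degree_le_operatorNorm (v : V) : √(G.degree v : ℝ) ≤ operatorNorm G := by
  have h := sum_card_neighborFinset_inter_le G {v} (G.neighborFinset v)
  simp only [sum_singleton, inter_self, SimpleGraph.card_neighborFinset_eq_degree,
    card_singleton, Nat.cast_one, Real.sqrt_one, one_mul] at h
  rcases eq_or_lt_of_le (Real.sqrt_nonneg (G.degree v : ℝ)) with h0 | h0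
  · rw [← h0]; exact operatorNorm_nonneg G
  · refine le_of_mul_le_mul_right ?_ h0
    rwa [Real.mul_self_sqrt (Nat.cast_nonneg _)]

theorem exists_card_neighborFinset_inter_le {B : Finset V} (hB : B.Nonempty) :
    ∃ u ∈ B, (#(G.neighborFinset u ∩ B) : ℝ) ≤ operatorNorm G := by
  refine Finset.exists_le_of_sum_le hB ?_
  refine (sum_card_neighborFinset_inter_le G B B).trans ?_
  rw [Real.mul_self_sqrt (Nat.cast_nonneg _), sum_const, nsmul_eq_mul, mul_comm]

/-- Greedy coloring by degeneracy: remove a vertex with fewer than k neighbors in B, color the rest,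
and give it a free color. -/
theorem exists_coloring_on {k : ℕ} (hk : operatorNorm G < k) (B : Finset V) :
    ∃ Y : V → Fin k, ∀ u ∈ B, ∀ v ∈ B, G.Adj u v → Y u ≠ Y v := by
  have hk0 : 0 < k := by exact_mod_cast (operatorNorm_nonneg G).trans_lt hk
  induction B using Finset.strongInduction with
  | H B ih =>
    rcases B.eq_empty_or_nonempty with rfl | hB
    · exact ⟨fun _ => ⟨0, hk0⟩, by simp⟩
    obtain ⟨u, hu, hdeg⟩ := exists_card_neighborFinset_inter_le G hB
    obtain ⟨Y, hY⟩ := ih _ (erase_ssubset hu)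
    have hlt : #((G.neighborFinset u ∩ B).image Y) < #(univ : Finset (Fin k)) := by
      rw [card_univ, Fintype.card_fin]
      refine card_image_le.trans_lt ?_
      exact_mod_cast hdeg.trans_lt hk
    obtain ⟨c, -, hc⟩ := exists_mem_notMem_of_card_lt_card hlt
    simp only [mem_image, mem_inter, SimpleGraph.mem_neighborFinset, not_exists, not_and,
      and_imp] at hc
    refine ⟨Function.update Y u c, fun x hx y hy hxy => ?_⟩
    rcases eq_or_ne x u with rfl | hxu
    · rw [Function.update_self, Function.update_of_ne hxy.ne']
      exact Ne.symm (hc y hxy hy)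
    rcases eq_or_ne y u with rfl | hyu
    · rw [Function.update_self, Function.update_of_ne hxu]
      exact hc x hxy.symm hx
    rw [Function.update_of_ne hxu, Function.update_of_ne hyu]
    exact hY x (mem_erase.2 ⟨hxu, hx⟩) y (mem_erase.2 ⟨hyu, hy⟩) hxy

theorem properColorings_nonempty {k : ℕ} (hk : operatorNorm G < k) :
    (properColorings G k).Nonempty := by
  obtain ⟨Y, hY⟩ := exists_coloring_on G hk univ
  exact ⟨Y, fun u v => hY u (mem_univ _) v (mem_univ _)⟩

end Spectral

/-! ### Invariance of the uniform measure under resampling. -/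

section Resampling

variable {V : Type*} [Fintype V] {G : SimpleGraph V} [DecidableRel G.Adj] {k : ℕ}

theorem mem_availableColors {Y : V → Fin k} {v : V} {c : Fin k} :
    c ∈ availableColors G Y v ↔ ∀ u, G.Adj v u → Y u ≠ c := by
  simp [availableColors]

variable [DecidableEq V]

variable (G k) in
open Classical in
/-- The proper `k`-colorings of `G`, as a finset. -/
noncomputable def properFinset : Finset (V → Fin k) := {Y | Y ∈ properColorings G k}

theorem mem_properFinset {V : Type*} [Fintype V] [DecidableEq V] {G : SimpleGraph V} {k : ℕ}
    {Y : V → Fin k} :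
    Y ∈ properFinset G k ↔ ∀ u v : V, G.Adj u v → Y u ≠ Y v := by
  simp only [properFinset, mem_filter, mem_univ, true_and]
  rfl

theorem availableColors_update (Y : V → Fin k) (u : V) (c : Fin k) :
    availableColors G (Function.update Y u c) u = availableColors G Y u := by
  ext d
  simp only [mem_availableColors]
  refine forall₂_congr fun x hx => ?_
  rw [Function.update_of_ne hx.ne']

theorem self_mem_availableColors {Y : V → Fin k} (hY : Y ∈ properFinset G k) (u : V) :
    Y u ∈ availableColors G Y u :=
  mem_availableColors.2 fun x hx => (mem_properFinset.1 hY u x hx).symm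

theorem update_mem_properFinset {Y : V → Fin k} (hY : Y ∈ properFinset G k) {u : V} {c : Fin k}
    (hc : c ∈ availableColors G Y u) : Function.update Y u c ∈ properFinset G k := by
  rw [mem_availableColors] at hc
  refine mem_properFinset.2 fun x y hxy => ?_
  rcases eq_or_ne x u with rfl | hxu
  · rw [Function.update_self, Function.update_of_ne hxy.ne']
    exact (hc y hxy).symm
  rcases eq_or_ne y u with rfl | hyu
  · rw [Function.update_self, Function.update_of_ne hxu]
    exact hc x hxy.symm
  rw [Function.update_of_ne hxu, Function.update_of_ne hyu]
  exact mem_properFinset.1 hY x y hxy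

theorem card_availableColors_pos {Y : V → Fin k} (hY : Y ∈ properFinset G k) (u : V) :
    (0 : ℝ) < #(availableColors G Y u) := by
  exact_mod_cast card_pos.2 ⟨_, self_mem_availableColors hY u⟩

/-- Resampling the color of a single vertex preserves the uniform measure on proper colorings. -/
theorem sum_resample (u : V) (f : (V → Fin k) → ℝ) :
    ∑ Y ∈ properFinset G k, f Y = ∑ Y ∈ properFinset G k,
      (∑ c ∈ availableColors G Y u, f (Function.update Y u c)) / #(availableColors G Y u) := by
  have h1 : ∑ Y ∈ properFinset G k, f Y = ∑ Y ∈ properFinset G k,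
      ∑ c ∈ availableColors G Y u, f Y / #(availableColors G Y u) := by
    refine sum_congr rfl fun Y hY => ?_
    rw [sum_const, nsmul_eq_mul, mul_div_cancel₀]
    exact (card_availableColors_pos hY u).ne'
  simp only [h1, sum_div]
  rw [sum_sigma', sum_sigma']
  -- Swapping the old color of u with the new one is an involution, and it keeps the set of colors
  -- available at u.
  refine sum_bij' (fun p _ => ⟨Function.update p.1 u p.2, p.1 u⟩)
    (fun p _ => ⟨Function.update p.1 u p.2, p.1 u⟩) ?_ ?_ ?_ ?_ ?_
  · rintro ⟨Y, c⟩ h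
    rw [mem_sigma] at h ⊢
    exact ⟨update_mem_properFinset h.1 h.2, by
      rw [availableColors_update]; exact self_mem_availableColors h.1 u⟩
  · rintro ⟨Y, c⟩ h
    rw [mem_sigma] at h ⊢
    exact ⟨update_mem_properFinset h.1 h.2, by
      rw [availableColors_update]; exact self_mem_availableColors h.1 u⟩
  · rintro ⟨Y, c⟩ h; simp
  · rintro ⟨Y, c⟩ h; simp
  · rintro ⟨Y, c⟩ h; simp [availableColors_update]

end Resampling

/-! ### Exponential moments of the number of unused colors. -/

section Concentration

variable {V : Type*} [Fintype V] [DecidableEq V] {G : SimpleGraph V} [DecidableRel G.Adj] {k : ℕ}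

open Classical in
/-- The colors that `Y` does not use on the vertices of `s` that are active for `Y`. -/
noncomputable def unusedColors (act : V → (V → Fin k) → Prop) (s : Finset V) (Y : V → Fin k) :
    Finset (Fin k) :=
  {c | ∀ x ∈ s, act x Y → Y x ≠ c}

theorem mem_unusedColors {act : V → (V → Fin k) → Prop} {s : Finset V} {Y : V → Fin k}
    {c : Fin k} : c ∈ unusedColors act s Y ↔ ∀ x ∈ s, act x Y → Y x ≠ c := by
  simp [unusedColors]

/-- The sum, over the colors not yet used on `s`, of a lower bound for the probability that
the color stays unused on all of `R`. -/
noncomputable def unusedPotential (act : V → (V → Fin k) → Prop)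
    (q : V → (V → Fin k) → Fin k → ℝ) (R s : Finset V) (Y : V → Fin k) : ℝ :=
  ∑ c ∈ unusedColors act s Y, ∏ x ∈ R \ s, (1 - q x Y c)

theorem exp_mul_le {l g : ℝ} (hl0 : 0 ≤ l) (hl1 : l ≤ 1) (hg0 : 0 ≤ g) (hg1 : g ≤ 1) :
    Real.exp (l * g) ≤ 1 + (l + l ^ 2) * g := by
  have h1 : |l * g| ≤ 1 := by
    rw [abs_of_nonneg (by positivity)]; exact mul_le_one₀ hl1 hg0 hg1
  have h2 := (abs_le.1 (Real.abs_exp_sub_one_sub_id_le h1)).2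
  have h3 : l ^ 2 * (g * g) ≤ l ^ 2 * g := by
    gcongr; exact mul_le_of_le_one_left hg0 hg1
  nlinarith

/-- One resampling step: a color d uniform in A lowers the value a by g d, a drop with mean at most
∑ q g. Second-order terms cost the factor exp(2l²). -/
theorem sum_exp_div_card_le {ι : Type*} [Fintype ι] {A : Finset ι} (hA : A.Nonempty)
    {g q : ι → ℝ} {l : ℝ} (hl0 : 0 ≤ l) (hl1 : l ≤ 1) (hg0 : ∀ c, 0 ≤ g c) (hg1 : ∀ c, g c ≤ 1)
    (hq0 : ∀ c, 0 ≤ q c) (hq : ∀ c ∈ A, 1 / (#A : ℝ) ≤ q c) (hsum : ∑ c, q c ≤ 2) (a : ℝ) :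
    (∑ d ∈ A, Real.exp (-l * (a - g d))) / #A
      ≤ Real.exp (2 * l ^ 2) * Real.exp (-l * (a - ∑ c, q c * g c)) := by
  have hA0 : (0 : ℝ) < #A := by exact_mod_cast hA.card_pos
  have h1 : (∑ d ∈ A, g d) / #A ≤ ∑ c, q c * g c := by
    rw [sum_div]
    refine (sum_le_sum fun d hd => ?_).trans
      (sum_le_univ_sum_of_nonneg fun c => mul_nonneg (hq0 c) (hg0 c))
    rw [div_eq_mul_one_div, mul_comm]
    exact mul_le_mul_of_nonneg_right (hq d hd) (hg0 d)
  have h2 : ∑ c, q c * g c ≤ 2 :=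
    (sum_le_sum fun c _ => mul_le_of_le_one_right (hq0 c) (hg1 c)).trans hsum
  calc (∑ d ∈ A, Real.exp (-l * (a - g d))) / #A
      ≤ (∑ d ∈ A, Real.exp (-l * a) * (1 + (l + l ^ 2) * g d)) / #A := by
        gcongr with d hd
        rw [show -l * (a - g d) = -l * a + l * g d by ring, Real.exp_add]
        gcongr
        exact exp_mul_le hl0 hl1 (hg0 d) (hg1 d)
    _ = Real.exp (-l * a) * (1 + (l + l ^ 2) * ((∑ d ∈ A, g d) / #A)) := by
        rw [← mul_sum, sum_add_distrib, ← mul_sum, sum_const, nsmul_eq_mul]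
        field_simp
    _ ≤ Real.exp (-l * a) * Real.exp ((l + l ^ 2) * ∑ c, q c * g c) := by
        gcongr
        refine le_trans ?_ (Real.add_one_le_exp _)
        rw [add_comm]
        gcongr
    _ ≤ _ := by
        rw [← Real.exp_add, ← Real.exp_add]
        refine Real.exp_le_exp.2 ?_
        -- The excess over l · ∑ q g is l² · ∑ q g, at most 2l².
        nlinarith [mul_le_mul_of_nonneg_left h2 (sq_nonneg l)]

variable {act : V → (V → Fin k) → Prop} {q : V → (V → Fin k) → Fin k → ℝ} {R : Finset V}

theorem unusedPotential_insert_update_of_not_act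
    (hq0 : ∀ x Y c, 0 ≤ q x Y c) (hq1 : ∀ x Y c, q x Y c ≤ 1)
    (hact : ∀ u ∈ R, ∀ x ∈ R, ∀ Y c, act x (Function.update Y u c) ↔ act x Y)
    (hinv : ∀ u ∈ R, ∀ x ∈ R, ∀ Y c, q x (Function.update Y u c) = q x Y)
    {s : Finset V} {u : V} (hsR : s ⊆ R) (huR : u ∈ R) (hus : u ∉ s) {Y : V → Fin k}
    (hu : ¬ act u Y) (d : Fin k) :
    unusedPotential act q R s Y
      ≤ unusedPotential act q R (insert u s) (Function.update Y u d) := by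
  have hU : unusedColors act (insert u s) (Function.update Y u d) = unusedColors act s Y := by
    ext c
    simp only [mem_unusedColors, forall_mem_insert]
    rw [hact u huR u huR]
    simp only [hu, false_imp_iff, true_and]
    refine forall₂_congr fun x hx => ?_
    rw [hact u huR x (hsR hx), Function.update_of_ne (ne_of_mem_of_not_mem hx hus)]
  rw [unusedPotential, unusedPotential, hU]
  refine sum_le_sum fun c _ => ?_
  have : R \ s = insert u (R \ insert u s) := by
    rw [sdiff_insert, insert_erase (mem_sdiff.2 ⟨huR, hus⟩)]
  rw [this, prod_insert (by simp)]
  have h2 : ∏ x ∈ R \ insert u s, (1 - q x (Function.update Y u d) c)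
      = ∏ x ∈ R \ insert u s, (1 - q x Y c) :=
    prod_congr rfl fun x hx => by rw [hinv u huR x (mem_sdiff.1 hx).1]
  rw [h2]
  refine mul_le_of_le_one_left (prod_nonneg fun x _ => ?_) ?_
  · linarith [hq1 x Y c]
  · linarith [hq0 u Y c]

theorem unusedPotential_insert_update_of_act
    (hact : ∀ u ∈ R, ∀ x ∈ R, ∀ Y c, act x (Function.update Y u c) ↔ act x Y)
    (hinv : ∀ u ∈ R, ∀ x ∈ R, ∀ Y c, q x (Function.update Y u c) = q x Y)
    {s : Finset V} {u : V} (hsR : s ⊆ R) (huR : u ∈ R) (hus : u ∉ s) {Y : V → Fin k}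
    (hu : act u Y) (d : Fin k) :
    unusedPotential act q R (insert u s) (Function.update Y u d) =
      ∑ c, (if c ∈ unusedColors act s Y then ∏ x ∈ R \ insert u s, (1 - q x Y c) else 0)
      - (if d ∈ unusedColors act s Y then ∏ x ∈ R \ insert u s, (1 - q x Y d) else 0) := by
  have hU : unusedColors act (insert u s) (Function.update Y u d)
      = (unusedColors act s Y).erase d := by
    ext c
    simp only [mem_unusedColors, forall_mem_insert, mem_erase]
    rw [hact u huR u huR, Function.update_self]
    refine and_congr ⟨fun h => (h hu).symm, fun h _ => h.symm⟩ (forall₂_congr fun x hx => ?_)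
    rw [hact u huR x (hsR hx), Function.update_of_ne (ne_of_mem_of_not_mem hx hus)]
  rw [unusedPotential, hU]
  have h2 (c : Fin k) : ∏ x ∈ R \ insert u s, (1 - q x (Function.update Y u d) c)
      = ∏ x ∈ R \ insert u s, (1 - q x Y c) :=
    prod_congr rfl fun x hx => by rw [hinv u huR x (mem_sdiff.1 hx).1]
  simp only [h2]
  rw [sum_ite_mem, univ_inter]
  split_ifs with hd
  · rw [eq_sub_iff_add_eq, sum_erase_add _ _ hd]
  · rw [erase_eq_of_notMem hd, sub_zero]

theorem unusedPotential_eq_sub {s : Finset V} {u : V} (huR : u ∈ R) (hus : u ∉ s)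
    (Y : V → Fin k) :
    unusedPotential act q R s Y =
      ∑ c, (if c ∈ unusedColors act s Y then ∏ x ∈ R \ insert u s, (1 - q x Y c) else 0)
      - ∑ c, q u Y c *
        (if c ∈ unusedColors act s Y then ∏ x ∈ R \ insert u s, (1 - q x Y c) else 0) := by
  have : R \ s = insert u (R \ insert u s) := by
    rw [sdiff_insert, insert_erase (mem_sdiff.2 ⟨huR, hus⟩)]
  simp only [mul_ite, mul_zero]
  rw [sum_ite_mem, sum_ite_mem, univ_inter, ← sum_sub_distrib, unusedPotential]
  refine sum_congr rfl fun c _ => ?_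
  rw [this, prod_insert (by simp)]
  ring

theorem sum_exp_unusedPotential_insert_le
    (hq0 : ∀ x Y c, 0 ≤ q x Y c) (hq1 : ∀ x Y c, q x Y c ≤ 1) (hsum : ∀ x Y, ∑ c, q x Y c ≤ 2)
    (hact : ∀ u ∈ R, ∀ x ∈ R, ∀ Y c, act x (Function.update Y u c) ↔ act x Y)
    (hinv : ∀ u ∈ R, ∀ x ∈ R, ∀ Y c, q x (Function.update Y u c) = q x Y)
    (hav : ∀ u ∈ R, ∀ Y ∈ properFinset G k, act u Y → ∀ c ∈ availableColors G Y u,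
      1 / (#(availableColors G Y u) : ℝ) ≤ q u Y c)
    {l : ℝ} (hl0 : 0 ≤ l) (hl1 : l ≤ 1)
    {s : Finset V} {u : V} (hsR : s ⊆ R) (huR : u ∈ R) (hus : u ∉ s) :
    ∑ Y ∈ properFinset G k, Real.exp (-l * unusedPotential act q R (insert u s) Y)
      ≤ Real.exp (2 * l ^ 2) *
        ∑ Y ∈ properFinset G k, Real.exp (-l * unusedPotential act q R s Y) := by
  rw [sum_resample u, mul_sum]
  refine sum_le_sum fun Y hY => ?_
  by_cases hu : act u Y
  · have hprod (c : Fin k) : 0 ≤ ∏ x ∈ R \ insert u s, (1 - q x Y c) :=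
      prod_nonneg fun x _ => by linarith [hq1 x Y c]
    simp only [unusedPotential_insert_update_of_act hact hinv hsR huR hus hu]
    rw [unusedPotential_eq_sub huR hus]
    refine sum_exp_div_card_le ⟨_, self_mem_availableColors hY u⟩ hl0 hl1 (fun c => ?_)
      (fun c => ?_) (hq0 u Y) (hav u huR Y hY hu) (hsum u Y) _
    · split_ifs
      exacts [hprod c, le_rfl]
    · split_ifs
      · exact prod_le_one (fun x _ => by linarith [hq1 x Y c]) fun x _ => by linarith [hq0 x Y c]
      · exact zero_le_one
  · rw [div_le_iff₀ (card_availableColors_pos hY u), mul_comm, ← nsmul_eq_mul]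
    refine sum_le_card_nsmul _ _ _ fun d _ => ?_
    refine le_trans (Real.exp_le_exp.2 ?_)
      (le_mul_of_one_le_left (Real.exp_nonneg _) (Real.one_le_exp (by positivity)))
    rw [neg_mul, neg_mul, neg_le_neg_iff]
    exact mul_le_mul_of_nonneg_left
      (unusedPotential_insert_update_of_not_act hq0 hq1 hact hinv hsR huR hus hu d) hl0

/-- Induct on the set s of exposed vertices. At s = ∅ the potential is the full sum of products, at
least m; at s = R it is the number of unused colors. -/
theorem sum_exp_card_unusedColors_le
    (hq0 : ∀ x Y c, 0 ≤ q x Y c) (hq1 : ∀ x Y c, q x Y c ≤ 1) (hsum : ∀ x Y, ∑ c, q x Y c ≤ 2)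
    (hact : ∀ u ∈ R, ∀ x ∈ R, ∀ Y c, act x (Function.update Y u c) ↔ act x Y)
    (hinv : ∀ u ∈ R, ∀ x ∈ R, ∀ Y c, q x (Function.update Y u c) = q x Y)
    (hav : ∀ u ∈ R, ∀ Y ∈ properFinset G k, act u Y → ∀ c ∈ availableColors G Y u,
      1 / (#(availableColors G Y u) : ℝ) ≤ q u Y c)
    {l : ℝ} (hl0 : 0 ≤ l) (hl1 : l ≤ 1) {m : ℝ}
    (hm : ∀ Y ∈ properFinset G k, m ≤ ∑ c, ∏ x ∈ R, (1 - q x Y c)) :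
    ∑ Y ∈ properFinset G k, Real.exp (-l * #(unusedColors act R Y))
      ≤ #(properFinset G k) * Real.exp (2 * l ^ 2 * #R - l * m) := by
  have key : ∀ s ⊆ R,
      ∑ Y ∈ properFinset G k, Real.exp (-l * unusedPotential act q R s Y)
        ≤ Real.exp (2 * l ^ 2 * #s) * (#(properFinset G k) * Real.exp (-l * m)) := by
    intro s
    induction s using Finset.induction with
    | empty =>
      intro _
      rw [card_empty, Nat.cast_zero, mul_zero, Real.exp_zero, one_mul, ← nsmul_eq_mul]
      refine sum_le_card_nsmul _ _ _ fun Y hY => Real.exp_le_exp.2 ?_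
      rw [neg_mul, neg_mul, neg_le_neg_iff]
      refine mul_le_mul_of_nonneg_left ((hm Y hY).trans_eq ?_) hl0
      simp [unusedPotential, unusedColors]
    | insert u s hus ih =>
      intro hR
      rw [insert_subset_iff] at hR
      refine (sum_exp_unusedPotential_insert_le hq0 hq1 hsum hact hinv hav hl0 hl1 hR.2 hR.1
        hus).trans ((mul_le_mul_of_nonneg_left (ih hR.2) (Real.exp_nonneg _)).trans_eq ?_)
      rw [← mul_assoc, ← Real.exp_add, card_insert_of_notMem hus]
      push_cast
      ring_nf
  refine le_trans (le_of_eq ?_) ((key R subset_rfl).trans_eq ?_)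
  · simp [unusedPotential]
  · rw [mul_left_comm, ← Real.exp_add]
    ring_nf

end Concentration

/-! ### Color probabilities conditioned on the coloring outside R. -/

section OuterColors

variable {V : Type*} {G : SimpleGraph V} {k : ℕ}

variable (G) in
open Classical in
/-- The colors that `Y` uses on no neighbor of `u` outside `R`. -/
noncomputable def outerColors (R : Finset V) (Y : V → Fin k) (u : V) : Finset (Fin k) :=
  {c | ∀ x, G.Adj u x → x ∉ R → Y x ≠ c}

theorem mem_outerColors {R : Finset V} {Y : V → Fin k} {u : V} {c : Fin k} :
    c ∈ outerColors G R Y u ↔ ∀ x, G.Adj u x → x ∉ R → Y x ≠ c := by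
  simp [outerColors]

theorem outerColors_update [DecidableEq V] {R : Finset V} {w : V} (hw : w ∈ R) (Y : V → Fin k) (c : Fin k)
    (u : V) : outerColors G R (Function.update Y w c) u = outerColors G R Y u := by
  ext d
  simp only [mem_outerColors]
  refine forall₃_congr fun x _ hx => ?_
  rw [Function.update_of_ne (ne_of_mem_of_not_mem hw hx).symm]

variable (G) in
open Classical in
/-- An upper bound for the probability that `u` gets the color `c`, given the colors outside
of `R`, when at least `T` colors are used by no neighbor of `u` outside `R`. -/
noncomputable def colorBound (T : ℝ) (R : Finset V) (u : V)
    (Y : V → Fin k) (c : Fin k) : ℝ :=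
  if T ≤ #(outerColors G R Y u) ∧ c ∈ outerColors G R Y u
    then 32 / 31 / (#(outerColors G R Y u) : ℝ) else 0

theorem colorBound_nonneg (T : ℝ) (R : Finset V) (u : V) (Y : V → Fin k) (c : Fin k) :
    0 ≤ colorBound G T R u Y c := by
  unfold colorBound; split_ifs <;> positivity

theorem colorBound_le {T : ℝ} (hT : 64 ≤ T) (R : Finset V) (u : V) (Y : V → Fin k) (c : Fin k) :
    colorBound G T R u Y c ≤ 1 / 62 := by
  unfold colorBound
  split_ifs with h
  · rw [div_le_iff₀ (by linarith [h.1])]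
    linarith [h.1]
  · norm_num

theorem sum_colorBound_le {T : ℝ} (hT : 0 < T) (R : Finset V) (u : V) (Y : V → Fin k) :
    ∑ c, colorBound G T R u Y c ≤ 32 / 31 := by
  by_cases h : T ≤ #(outerColors G R Y u)
  · simp only [colorBound, h, true_and]
    rw [sum_ite_mem, univ_inter, sum_const, nsmul_eq_mul, mul_div_cancel₀]
    exact (hT.trans_le h).ne'
  · simp only [colorBound, h, false_and, if_false, sum_const_zero]
    norm_num

end OuterColors

/-! ### The neighborhood of one vertex, and the union bound. -/

section Local

variable {V : Type*} [Fintype V] {G : SimpleGraph V} [DecidableRel G.Adj] {k : ℕ}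

theorem availableColors_subset_outerColors (R : Finset V) (Y : V → Fin k) (u : V) :
    availableColors G Y u ⊆ outerColors G R Y u := fun _ hc =>
  mem_outerColors.2 fun x hx _ => mem_availableColors.1 hc x hx

variable (G) in
open Classical in
/-- The vertices at which fewer than `T` colors are available. -/
noncomputable def badVertices (T : ℝ) (Y : V → Fin k) : Finset V :=
  {u | (#(availableColors G Y u) : ℝ) < T}

theorem mem_badVertices {T : ℝ} {Y : V → Fin k} {u : V} :
    u ∈ badVertices G T Y ↔ (#(availableColors G Y u) : ℝ) < T := by
  simp [badVertices]

variable [DecidableEq V]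

theorem card_outerColors_le (R : Finset V) (Y : V → Fin k) (u : V) :
    #(outerColors G R Y u) ≤ #(availableColors G Y u) + #(G.neighborFinset u ∩ R) := by
  refine (card_le_card (t := availableColors G Y u ∪ (G.neighborFinset u ∩ R).image Y)
    fun c hc => ?_).trans ((card_union_le _ _).trans (by gcongr; exact card_image_le))
  rw [mem_outerColors] at hc
  by_cases h : c ∈ availableColors G Y u
  · exact mem_union_left _ h
  · refine mem_union_right _ ?_
    simp only [mem_availableColors, not_forall, not_not] at h
    obtain ⟨x, hx, hxc⟩ := h
    refine mem_image.2 ⟨x, mem_inter.2 ⟨(G.mem_neighborFinset u x).2 hx, ?_⟩, hxc⟩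
    by_contra hxR
    exact hc x hx hxR hxc

variable (G) in
open Classical in
/-- The neighbors of `v` that have at most `T / 32` common neighbors with `v`. -/
noncomputable def sparseNeighbors (T : ℝ) (v : V) : Finset V :=
  {u ∈ G.neighborFinset v | 32 * (#(G.neighborFinset u ∩ G.neighborFinset v) : ℝ) ≤ T}

theorem sparseNeighbors_subset (T : ℝ) (v : V) :
    sparseNeighbors G T v ⊆ G.neighborFinset v := filter_subset _ _

/-- Each discarded neighbor sends more than T/32 edges into the neighborhood of v, while the mixing
bound caps their total at ρ√(#S · Δ). -/
theorem card_neighborFinset_sdiff_sparseNeighbors_le {T : ℝ} (hT : 0 < T) (v : V) :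
    (#(G.neighborFinset v \ sparseNeighbors G T v) : ℝ)
      ≤ 1024 * operatorNorm G ^ 2 * G.maxDegree / T ^ 2 := by
  set S := G.neighborFinset v \ sparseNeighbors G T v with hS
  have hdeg : (G.degree v : ℝ) ≤ G.maxDegree := by exact_mod_cast G.degree_le_maxDegree v
  have h1 : (#S : ℝ) * (T / 32)
      ≤ ∑ u ∈ S, (#(G.neighborFinset u ∩ G.neighborFinset v) : ℝ) := by
    rw [← nsmul_eq_mul]
    refine card_nsmul_le_sum _ _ _ fun u hu => ?_
    rw [hS, mem_sdiff, sparseNeighbors, mem_filter, not_and, not_le] at hu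
    linarith [hu.2 hu.1]
  have h2 := h1.trans (sum_card_neighborFinset_inter_le G S (G.neighborFinset v))
  rw [SimpleGraph.card_neighborFinset_eq_degree] at h2
  have h3 : √(#S : ℝ) * (T / 32) ≤ operatorNorm G * √(G.maxDegree : ℝ) := by
    rcases eq_or_lt_of_le (Real.sqrt_nonneg (#S : ℝ)) with h0 | h0
    · rw [← h0, zero_mul]
      exact mul_nonneg (operatorNorm_nonneg G) (Real.sqrt_nonneg _)
    · refine le_of_mul_le_mul_left ?_ h0
      calc √(#S : ℝ) * (√(#S : ℝ) * (T / 32)) = #S * (T / 32) := by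
            rw [← mul_assoc, Real.mul_self_sqrt (Nat.cast_nonneg _)]
        _ ≤ operatorNorm G * (√(#S : ℝ) * √(G.degree v : ℝ)) := h2
        _ ≤ operatorNorm G * (√(#S : ℝ) * √(G.maxDegree : ℝ)) := by
            gcongr; exact operatorNorm_nonneg G
        _ = _ := by ring
  have h4 := pow_le_pow_left₀ (by positivity) h3 2
  rw [mul_pow, mul_pow, Real.sq_sqrt (Nat.cast_nonneg _), Real.sq_sqrt (Nat.cast_nonneg _)] at h4
  rw [le_div_iff₀ (by positivity)]
  linarith

theorem exp_neg_mul_le_one_sub {q : ℝ} (h0 : 0 ≤ q) (h1 : q ≤ 1 / 62) :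
    Real.exp (-(62 / 61 * q)) ≤ 1 - q := by
  rw [Real.exp_neg]
  refine inv_le_of_inv_le₀ (by linarith) (le_trans ?_ (Real.add_one_le_exp _))
  rw [inv_le_iff_one_le_mul₀ (by linarith)]
  nlinarith

/-- Convexity of exp: bounding each product below by a tangent line makes the sum over colors linear
in q. The constant works because 62/61 · 32/31 < 11/10. -/
theorem mul_exp_le_sum_prod_one_sub {ι : Type*} (R : Finset ι) (hk : 0 < k)
    {q : ι → Fin k → ℝ} (h0 : ∀ x c, 0 ≤ q x c) (h1 : ∀ x c, q x c ≤ 1 / 62)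
    (hsum : ∀ x, ∑ c, q x c ≤ 32 / 31) :
    k * Real.exp (-(11 / 10 * #R / k)) ≤ ∑ c, ∏ x ∈ R, (1 - q x c) := by
  set b : ℝ := 11 / 10 * #R / k with hb
  have hk' : (0 : ℝ) < k := by exact_mod_cast hk
  have hkb : k * b = 11 / 10 * #R := by rw [hb]; field_simp
  have h2 (c : Fin k) : Real.exp (-b) * (1 + b - 62 / 61 * ∑ x ∈ R, q x c)
      ≤ ∏ x ∈ R, (1 - q x c) := by
    calc _ ≤ Real.exp (-b) * Real.exp (b - 62 / 61 * ∑ x ∈ R, q x c) := by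
          gcongr
          linarith [Real.add_one_le_exp (b - 62 / 61 * ∑ x ∈ R, q x c)]
      _ = ∏ x ∈ R, Real.exp (-(62 / 61 * q x c)) := by
          rw [← Real.exp_add, ← Real.exp_sum, mul_sum, sum_neg_distrib]
          ring_nf
      _ ≤ _ := prod_le_prod (fun _ _ => Real.exp_nonneg _)
          fun x _ => exp_neg_mul_le_one_sub (h0 x c) (h1 x c)
  refine le_trans ?_ (sum_le_sum fun c _ => h2 c)
  rw [← mul_sum, mul_comm]
  gcongr
  rw [sum_sub_distrib, sum_const, card_univ, Fintype.card_fin, nsmul_eq_mul, ← mul_sum, sum_comm]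
  have h3 : ∑ x ∈ R, ∑ c, q x c ≤ #R * (32 / 31) := by
    rw [← nsmul_eq_mul]
    exact sum_le_card_nsmul _ _ _ fun x _ => hsum x
  have h4 : (0 : ℝ) ≤ #R := Nat.cast_nonneg _
  linarith

/-- Neighbors of u inside R block at most T/32 colors, hence at most 1/32 of the outer colors of an
active u. -/
theorem one_div_card_availableColors_le_colorBound {T : ℝ} {v u : V}
    (hu : u ∈ sparseNeighbors G T v) {Y : V → Fin k} (hY : Y ∈ properFinset G k)
    (hact : T ≤ #(outerColors G (sparseNeighbors G T v) Y u)) {c : Fin k}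
    (hc : c ∈ availableColors G Y u) :
    1 / (#(availableColors G Y u) : ℝ) ≤ colorBound G T (sparseNeighbors G T v) u Y c := by
  rw [colorBound, if_pos ⟨hact, availableColors_subset_outerColors _ _ _ hc⟩]
  have h0 := card_availableColors_pos hY u
  have h1 : (#(outerColors G (sparseNeighbors G T v) Y u) : ℝ)
      ≤ #(availableColors G Y u) + #(G.neighborFinset u ∩ sparseNeighbors G T v) := by
    exact_mod_cast card_outerColors_le _ _ _
  have h2 : (#(G.neighborFinset u ∩ sparseNeighbors G T v) : ℝ)
      ≤ #(G.neighborFinset u ∩ G.neighborFinset v) := by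
    exact_mod_cast card_le_card (inter_subset_inter_left (sparseNeighbors_subset T v))
  have h3 := (mem_filter.1 hu).2
  have h4 : (#(availableColors G Y u) : ℝ) ≤ #(outerColors G (sparseNeighbors G T v) Y u) := by
    exact_mod_cast card_le_card (availableColors_subset_outerColors _ _ _)
  rw [div_le_div_iff₀ h0 (h0.trans_le h4)]
  linarith

open Classical in
theorem card_filter_unusedColors_lt_le (hk : 0 < k) {T : ℝ} (hT : 64 ≤ T) (v : V) {m : ℝ}
    (hm0 : 0 ≤ m) (hm1 : m ≤ 8 * G.maxDegree) (hd : 0 < G.maxDegree)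
    (hm : m ≤ k * Real.exp (-(11 / 10 * G.maxDegree / k))) :
    (#{Y ∈ properFinset G k | (#(unusedColors
        (fun u Y => T ≤ (#(outerColors G (sparseNeighbors G T v) Y u) : ℝ))
        (sparseNeighbors G T v) Y) : ℝ) < m / 2} : ℝ)
      ≤ #(properFinset G k) * Real.exp (-(m ^ 2 / (32 * G.maxDegree))) := by
  set R := sparseNeighbors G T v with hR
  set act : V → (V → Fin k) → Prop := fun u Y => T ≤ (#(outerColors G R Y u) : ℝ) with hact
  have hd' : (0 : ℝ) < G.maxDegree := by exact_mod_cast hd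
  have hRd : (#R : ℝ) ≤ G.maxDegree := by
    refine (Nat.cast_le.2 (card_le_card (sparseNeighbors_subset T v))).trans ?_
    rw [SimpleGraph.card_neighborFinset_eq_degree]
    exact_mod_cast G.degree_le_maxDegree v
  -- This minimizes the Chernoff exponent 2l²Δ - lm + lm/2.
  set l : ℝ := m / (8 * G.maxDegree) with hl
  have hl0 : 0 ≤ l := by positivity
  have hl1 : l ≤ 1 := (div_le_one (by positivity)).2 hm1
  have key := sum_exp_card_unusedColors_le (G := G) (act := act) (q := colorBound G T R) (R := R)
    (m := m) (colorBound_nonneg T R)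
    (fun x Y c => (colorBound_le hT R x Y c).trans (by norm_num))
    (fun x Y => (sum_colorBound_le (by linarith) R x Y).trans (by norm_num))
    (fun u hu x _ Y c => by simp only [hact, outerColors_update hu])
    (fun u hu x _ Y c => by funext d; simp only [colorBound, outerColors_update hu])
    (fun u hu Y hY hau c hc => one_div_card_availableColors_le_colorBound hu hY hau hc)
    hl0 hl1 (fun Y _ => by
      refine (hm.trans ?_).trans (mul_exp_le_sum_prod_one_sub R hk
        (fun x c => colorBound_nonneg T R x Y c) (fun x c => colorBound_le hT R x Y c)
        fun x => sum_colorBound_le (by linarith) R x Y)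
      gcongr)
  set F := {Y ∈ properFinset G k | (#(unusedColors act R Y) : ℝ) < m / 2} with hF
  have h1 : (#F : ℝ) * Real.exp (-l * (m / 2))
      ≤ ∑ Y ∈ properFinset G k, Real.exp (-l * #(unusedColors act R Y)) := by
    rw [← nsmul_eq_mul]
    refine le_trans (card_nsmul_le_sum _ _ _ fun Y hY => Real.exp_le_exp.2 ?_)
      (sum_le_sum_of_subset_of_nonneg (filter_subset _ _) fun _ _ _ => Real.exp_nonneg _)
    rw [neg_mul, neg_mul, neg_le_neg_iff]
    exact mul_le_mul_of_nonneg_left (mem_filter.1 hY).2.le hl0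
  have h2 := h1.trans key
  rw [← le_div_iff₀ (Real.exp_pos _), mul_div_assoc, ← Real.exp_sub] at h2
  refine h2.trans ?_
  gcongr
  have h3 : l * m = m ^ 2 / (8 * G.maxDegree) := by rw [hl]; ring
  have h4 : 2 * l ^ 2 * G.maxDegree = m ^ 2 / (32 * G.maxDegree) := by
    rw [hl]; field_simp; ring
  have h5 : 2 * l ^ 2 * #R ≤ 2 * l ^ 2 * G.maxDegree := by gcongr
  have h6 : m ^ 2 / (8 * G.maxDegree) = 4 * (m ^ 2 / (32 * G.maxDegree)) := by
    field_simp; ring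
  linarith

/-- A color unused by active vertices of R is available at v, or appears on a neighbor outside R or
on an inactive one. Inactive vertices are bad, since available colors are outer colors. -/
theorem card_unusedColors_lt {T : ℝ} {v : V} {Y : V → Fin k} {t : ℝ}
    (hv : v ∈ badVertices G T Y) (ht : (#(G.neighborFinset v ∩ badVertices G T Y) : ℝ) ≤ t) :
    (#(unusedColors (fun u Y => T ≤ (#(outerColors G (sparseNeighbors G T v) Y u) : ℝ))
        (sparseNeighbors G T v) Y) : ℝ)
      < T + t + #(G.neighborFinset v \ sparseNeighbors G T v) := by
  set R := sparseNeighbors G T v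
  have h1 : unusedColors (fun u Y => T ≤ (#(outerColors G R Y u) : ℝ)) R Y
      ⊆ availableColors G Y v ∪ (G.neighborFinset v ∩ badVertices G T Y).image Y
        ∪ (G.neighborFinset v \ R).image Y := by
    intro c hc
    rw [mem_unusedColors] at hc
    by_contra hcon
    simp only [mem_union, not_or, mem_image, not_exists, not_and, mem_availableColors,
      mem_inter, mem_sdiff, SimpleGraph.mem_neighborFinset, not_forall, not_not] at hcon
    obtain ⟨⟨⟨x, hx, hxc⟩, hbad⟩, hR⟩ := hcon
    have hxR : x ∈ R := by
      by_contra h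
      exact hR x ⟨hx, h⟩ hxc
    refine hc x hxR ?_ hxc
    by_contra h
    refine hbad x ⟨hx, mem_badVertices.2 (lt_of_le_of_lt ?_ (not_le.1 h))⟩ hxc
    exact_mod_cast card_le_card (availableColors_subset_outerColors R Y x)
  have h2 : (#(unusedColors (fun u Y => T ≤ (#(outerColors G R Y u) : ℝ)) R Y) : ℝ)
      ≤ #(availableColors G Y v) + #(G.neighborFinset v ∩ badVertices G T Y)
        + #(G.neighborFinset v \ R) := by
    refine (Nat.cast_le.2 ((card_le_card h1).trans ((card_union_le _ _).trans
      (add_le_add ((card_union_le _ _).trans (add_le_add le_rfl card_image_le))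
        card_image_le)))).trans_eq ?_
    push_cast
    rfl
  linarith [mem_badVertices.1 hv]

open Classical in
theorem card_filter_exists_bad_le (hk : 0 < k) {T : ℝ} (hT : 64 ≤ T) {m : ℝ}
    (hm1 : m ≤ 8 * G.maxDegree) (hd : 0 < G.maxDegree)
    (hm : m ≤ k * Real.exp (-(11 / 10 * G.maxDegree / k)))
    (hm2 : 2 * (T + operatorNorm G + 1024 * operatorNorm G ^ 2 * G.maxDegree / T ^ 2) ≤ m) :
    (#{Y ∈ properFinset G k | ∃ v, (#(availableColors G Y v) : ℝ) < T} : ℝ)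
      ≤ Fintype.card V *
        (#(properFinset G k) * Real.exp (-(m ^ 2 / (32 * G.maxDegree)))) := by
  have hρ := operatorNorm_nonneg G
  have hm0 : 0 ≤ m := le_trans (by positivity) hm2
  have hsub : {Y ∈ properFinset G k | ∃ v, (#(availableColors G Y v) : ℝ) < T} ⊆
      univ.biUnion fun v : V => {Y ∈ properFinset G k | (#(unusedColors
        (fun u Y => T ≤ (#(outerColors G (sparseNeighbors G T v) Y u) : ℝ))
        (sparseNeighbors G T v) Y) : ℝ) < m / 2} := by
    intro Y hY
    obtain ⟨hY, w, hw⟩ := mem_filter.1 hY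
    -- The given bad vertex w may have many bad neighbors, so it is traded for a bad v with at most
    -- ρ of them.
    obtain ⟨v, hv, hle⟩ := exists_card_neighborFinset_inter_le G
      ⟨w, mem_badVertices.2 hw⟩
    refine mem_biUnion.2 ⟨v, mem_univ _, mem_filter.2 ⟨hY, ?_⟩⟩
    have h1 := card_unusedColors_lt hv hle
    have h2 := card_neighborFinset_sdiff_sparseNeighbors_le (G := G) (T := T) (by linarith) v
    linarith
  refine (Nat.cast_le.2 ((card_le_card hsub).trans card_biUnion_le)).trans ?_
  rw [Nat.cast_sum, ← card_univ, ← nsmul_eq_mul]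
  exact sum_le_card_nsmul _ _ _ fun v _ => card_filter_unusedColors_lt_le hk hT v hm0 hm1 hd hm

end Local

/-! ### The uniform measure as a ratio of cardinalities. -/

section Probability

variable {V : Type*} [Fintype V] [DecidableEq V] {G : SimpleGraph V} {k : ℕ}

open Classical in
theorem uniformOn_properColorings_real (p : (V → Fin k) → Prop) :
    (ProbabilityTheory.uniformOn (properColorings G k)).real {Y | p Y}
      = #{Y ∈ properFinset G k | p Y} / #(properFinset G k) := by
  have h : properColorings G k = (properFinset G k : Set (V → Fin k)) := by
    ext Y; simp [properFinset]
  have h2 : properColorings G k ∩ {Y | p Y}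
      = (({Y ∈ properFinset G k | p Y} : Finset (V → Fin k)) : Set (V → Fin k)) := by
    ext Y; simp [properFinset]
  rw [MeasureTheory.measureReal_def, ProbabilityTheory.uniformOn,
    ProbabilityTheory.cond_apply (Set.toFinite _).measurableSet, h2, h,
    MeasureTheory.Measure.count_apply_finset, MeasureTheory.Measure.count_apply_finset,
    ENNReal.toReal_mul, ENNReal.toReal_inv, ENNReal.toReal_natCast, ENNReal.toReal_natCast,
    div_eq_inv_mul]

end Probability

/-! ### Numerical estimates for large n. -/

section Asymptotics

open Filter

theorem eventually_degree_bounds {ε : ℝ} (hε : 0 < ε) (hε2 : ε ≤ 1 / 2) :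
    ∀ᶠ x : ℝ in atTop, 1 < x ∧ 64 ≤ x ^ (1 - ε / 2) ∧ 2052 ≤ x ^ (ε / 5) ∧
      Real.log x < 4 * ε⁻¹ * x ^ (ε / 40) := by
  have h1 := (tendsto_rpow_atTop (y := 1 - ε / 2) (by linarith)).eventually_ge_atTop 64
  have h2 := (tendsto_rpow_atTop (y := ε / 5) (by linarith)).eventually_ge_atTop 2052
  have h3 := (isLittleO_log_rpow_atTop (r := ε / 40) (by linarith)).bound
    (c := 2 * ε⁻¹) (by positivity)
  filter_upwards [h1, h2, h3, eventually_gt_atTop 1] with x h1 h2 h3 h4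
  refine ⟨h4, h1, h2, ?_⟩
  have h5 : 0 < x ^ (ε / 40) := Real.rpow_pos_of_pos (by linarith) _
  rw [Real.norm_eq_abs, Real.norm_eq_abs, abs_of_pos h5] at h3
  have h6 : 0 < ε⁻¹ * x ^ (ε / 40) := by positivity
  linarith [le_abs_self (Real.log x)]

theorem eventually_le_mul_log_rpow {ε c : ℝ} (hε : 0 < ε) (hc : 0 < c) (K : ℝ) :
    ∀ᶠ n : ℕ in atTop, K ≤ c * Real.log n ^ (1 + ε) :=
  (((tendsto_rpow_atTop (y := 1 + ε) (by linarith)).const_mul_atTop hc).comp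
    (Real.tendsto_log_atTop.comp tendsto_natCast_atTop_atTop)).eventually_ge_atTop K

theorem eventually_log_bounds {ε c : ℝ} (hε : 0 < ε) (hε2 : ε ≤ 1 / 2) (hc : 0 < c) (K : ℝ) :
    ∀ᶠ n : ℕ in atTop, 0 < n ∧ ∀ x : ℝ, c * Real.log n ^ (1 + ε) ≤ x →
      K ≤ x ∧ 160 * Real.log n ≤ x ^ (1 - 3 / 5 * ε) := by
  have hlog : Tendsto (fun n : ℕ => Real.log n) atTop atTop :=
    Real.tendsto_log_atTop.comp tendsto_natCast_atTop_atTop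
  -- This equals ε(2 - 3ε)/5, positive as ε ≤ 1/2; it makes Δ^(1-3ε/5) outgrow ln n.
  have hexp : 0 < (1 + ε) * (1 - 3 / 5 * ε) - 1 := by nlinarith
  have hc' : 0 < c ^ (1 - 3 / 5 * ε) := Real.rpow_pos_of_pos hc _
  have h2 : ∀ᶠ L : ℝ in atTop,
      160 ≤ c ^ (1 - 3 / 5 * ε) * L ^ ((1 + ε) * (1 - 3 / 5 * ε) - 1) :=
    ((tendsto_rpow_atTop hexp).const_mul_atTop hc').eventually_ge_atTop 160
  filter_upwards [eventually_le_mul_log_rpow hε hc K, hlog.eventually h2,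
    hlog.eventually (eventually_gt_atTop 0), eventually_gt_atTop 0] with n h1 h2 h3 h4
  refine ⟨h4, fun x hx => ⟨h1.trans hx, ?_⟩⟩
  set L := Real.log n
  calc 160 * L ≤ c ^ (1 - 3 / 5 * ε) * L ^ ((1 + ε) * (1 - 3 / 5 * ε) - 1) * L := by gcongr
    _ = (c * L ^ (1 + ε)) ^ (1 - 3 / 5 * ε) := by
        rw [Real.mul_rpow hc.le (by positivity), ← Real.rpow_mul h3.le, Real.rpow_sub_one h3.ne',
          mul_assoc, div_mul_cancel₀ _ h3.ne']
    _ ≤ x ^ (1 - 3 / 5 * ε) := by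
        refine Real.rpow_le_rpow (by positivity) hx ?_
        linarith

/-- The exponential costs at most x^(11ε/40) and the logarithm in k at most x^(ε/40), together
x^(3ε/10). -/
theorem rpow_le_mul_exp {ε x k : ℝ} (hε : 0 < ε) (hx : 1 < x)
    (hlog : Real.log x < 4 * ε⁻¹ * x ^ (ε / 40)) (hk : 4 * ε⁻¹ * x / Real.log x < k) :
    x ^ (1 - 3 / 10 * ε) ≤ k * Real.exp (-(11 / 10 * x / k)) := by
  have hx0 : 0 < x := by linarith
  have hl : 0 < Real.log x := Real.log_pos hx
  have hk0 : 0 < k := lt_trans (by positivity) hk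
  have h1 : 11 / 10 * x / k ≤ Real.log x * (11 / 40 * ε) := by
    rw [div_lt_iff₀ hl] at hk
    rw [div_le_iff₀ hk0]
    have : x < k * Real.log x * ε / 4 := by
      calc x = 4 * ε⁻¹ * x * (ε / 4) := by field_simp
        _ < k * Real.log x * (ε / 4) := by gcongr
        _ = _ := by ring
    linarith
  calc x ^ (1 - 3 / 10 * ε) = x * x ^ (-(ε / 40)) * x ^ (-(11 / 40 * ε)) := by
        nth_rw 2 [← Real.rpow_one x]
        rw [← Real.rpow_add hx0, ← Real.rpow_add hx0]
        ring_nf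
    _ ≤ 4 * ε⁻¹ * x / Real.log x * x ^ (-(11 / 40 * ε)) := by
        gcongr
        rw [Real.rpow_neg hx0.le, ← div_eq_mul_inv, div_le_div_iff₀ (by positivity) hl]
        nlinarith
    _ ≤ k * Real.exp (-(11 / 10 * x / k)) := by
        rw [Real.rpow_def_of_pos hx0]
        gcongr
        linarith

/-- With T = x^(1-ε/2), the three terms are at most T, T and 1024T, and 2052 = 2(1 + 1 + 1024). -/
theorem threshold_bound {ε x ρ : ℝ} (hε : 0 < ε) (hx : 1 < x) (hρ0 : 0 ≤ ρ)
    (hρ : ρ ≤ x ^ (1 - ε)) (h : 2052 ≤ x ^ (ε / 5)) :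
    2 * (x ^ (1 - ε / 2) + ρ + 1024 * ρ ^ 2 * x / (x ^ (1 - ε / 2)) ^ 2)
      ≤ x ^ (1 - 3 / 10 * ε) := by
  have hx0 : 0 < x := by linarith
  have h1 : x ^ (1 - ε) ≤ x ^ (1 - ε / 2) :=
    Real.rpow_le_rpow_of_exponent_le hx.le (by linarith)
  have h2 : 1024 * ρ ^ 2 * x / (x ^ (1 - ε / 2)) ^ 2 ≤ 1024 * x ^ (1 - ε) := by
    calc _ ≤ 1024 * (x ^ (1 - ε)) ^ 2 * x / (x ^ (1 - ε / 2)) ^ 2 := by gcongr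
      _ = 1024 * x ^ (1 - ε) := by
        rw [div_eq_iff (by positivity)]
        have h3 : (x ^ (1 - ε / 2)) ^ 2 = x ^ (1 - ε) * x := by
          nth_rw 3 [← Real.rpow_one x]
          rw [← Real.rpow_add hx0, sq, ← Real.rpow_add hx0]
          ring_nf
        rw [h3]
        ring
  have h4 : x ^ (1 - 3 / 10 * ε) = x ^ (ε / 5) * x ^ (1 - ε / 2) := by
    rw [← Real.rpow_add hx0]
    ring_nf
  have h5 : 2052 * x ^ (1 - ε / 2) ≤ x ^ (ε / 5) * x ^ (1 - ε / 2) := by gcongr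
  rw [h4]
  linarith

theorem card_mul_exp_le {n : ℕ} (hn : 0 < n) {ε x : ℝ} (hx : 0 < x)
    (h : 160 * Real.log n ≤ x ^ (1 - 3 / 5 * ε)) :
    (n : ℝ) * Real.exp (-((x ^ (1 - 3 / 10 * ε)) ^ 2 / (32 * x))) ≤ (n : ℝ) ^ (-4 : ℤ) := by
  have hn0 : (0 : ℝ) < n := by exact_mod_cast hn
  have h1 : (x ^ (1 - 3 / 10 * ε)) ^ 2 / (32 * x) = x ^ (1 - 3 / 5 * ε) / 32 := by
    have : (x ^ (1 - 3 / 10 * ε)) ^ 2 = x ^ (1 - 3 / 5 * ε) * x := by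
      nth_rw 3 [← Real.rpow_one x]
      rw [← Real.rpow_add hx, sq, ← Real.rpow_add hx]
      ring_nf
    rw [this]
    field_simp
  rw [h1]
  -- As 160 = 5 · 32, the failure probability per vertex is at most n^(-5); the union bound loses a
  -- factor n.
  calc (n : ℝ) * Real.exp (-(x ^ (1 - 3 / 5 * ε) / 32))
      ≤ Real.exp (Real.log n) * Real.exp (-5 * Real.log n) := by
        rw [Real.exp_log hn0]
        gcongr
        linarith
    _ = (n : ℝ) ^ (-4 : ℤ) := by
        rw [← Real.exp_add, ← Real.rpow_intCast, Real.rpow_def_of_pos hn0]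
        push_cast
        ring_nf

theorem le_half_of_operatorNorm_le {V : Type*} [Fintype V] [DecidableEq V] {G : SimpleGraph V}
    [DecidableRel G.Adj] {ε : ℝ} (hd : 1 < G.maxDegree)
    (hρ : operatorNorm G ≤ (G.maxDegree : ℝ) ^ (1 - ε)) : ε ≤ 1 / 2 := by
  have hV : Nonempty V := by
    by_contra h
    rw [not_nonempty_iff] at h
    simp at hd
  obtain ⟨v, hv⟩ := G.exists_maximal_degree_vertex
  have h1 := (sqrt_degree_le_operatorNorm G v).trans hρ
  rw [← hv, Real.sqrt_eq_rpow, Real.rpow_le_rpow_left_iff (by exact_mod_cast hd)] at h1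
  linarith

end Asymptotics

end UniformColoring

theorem mainTheorem5 (ε : ℝ) (hε : 0 < ε) (c : ℝ) (hc : 0 < c) :
    ∃ n₀ : ℕ, ∀ (V : Type*) [Fintype V] [DecidableEq V]
      (G : SimpleGraph V) [DecidableRel G.Adj] (k : ℕ),
      n₀ ≤ Fintype.card V →
      UniformColoring.operatorNorm G ≤ (G.maxDegree : ℝ) ^ (1 - ε) →
      c * Real.log (Fintype.card V : ℝ) ^ (1 + ε) ≤ (G.maxDegree : ℝ) →
      4 * ε⁻¹ * (G.maxDegree : ℝ) / Real.log (G.maxDegree : ℝ) < (k : ℝ) →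
      (UniformColoring.properColorings G k).Nonempty ∧
      (ProbabilityTheory.uniformOn (UniformColoring.properColorings G k)).real
          {Y | ∃ v : V, ((UniformColoring.availableColors G Y v).card : ℝ)
            < (G.maxDegree : ℝ) ^ (1 - ε / 2)}
        ≤ (Fintype.card V : ℝ) ^ (-4 : ℤ) := by
  classical
  -- For ε > 1/2 no graph qualifies once Δ ≥ 2, because √Δ ≤ ρ.
  rcases lt_or_ge (1 / 2) ε with hε2 | hε2
  · obtain ⟨n₀, hn₀⟩ := Filter.eventually_atTop.1
      (UniformColoring.eventually_le_mul_log_rpow hε hc 2)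
    refine ⟨n₀, fun V _ _ G _ k hn hρ hΔ _ => absurd ?_ (not_le.2 hε2)⟩
    have hd : (2 : ℝ) ≤ G.maxDegree := (hn₀ _ hn).trans hΔ
    exact UniformColoring.le_half_of_operatorNorm_le (by exact_mod_cast hd) hρ
  obtain ⟨K, hK⟩ := Filter.eventually_atTop.1
    (UniformColoring.eventually_degree_bounds hε hε2)
  obtain ⟨n₀, hn₀⟩ := Filter.eventually_atTop.1
    (UniformColoring.eventually_log_bounds hε hε2 hc K)
  refine ⟨n₀, fun V _ _ G _ k hn hρ hΔ hk => ?_⟩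
  obtain ⟨hn0, hn1⟩ := hn₀ _ hn
  obtain ⟨hxK, hx160⟩ := hn1 _ hΔ
  obtain ⟨hx1, hT, h2052, hlog⟩ := hK _ hxK
  set x : ℝ := (G.maxDegree : ℝ) with hx
  have hx0 : 0 < x := by linarith
  have hl : 0 < Real.log x := Real.log_pos hx1
  have hρ0 := UniformColoring.operatorNorm_nonneg G
  have hρk : UniformColoring.operatorNorm G < k := by
    refine (hρ.trans ?_).trans_lt hk
    rw [le_div_iff₀ hl]
    calc x ^ (1 - ε) * Real.log x ≤ x ^ (1 - ε) * (4 * ε⁻¹ * x ^ ε) := by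
          gcongr
          refine hlog.le.trans ?_
          gcongr
          · exact hx1.le
          · linarith
      _ = 4 * ε⁻¹ * x := by
          rw [mul_left_comm, ← Real.rpow_add hx0, sub_add_cancel, Real.rpow_one]
  have hne := UniformColoring.properColorings_nonempty G hρk
  refine ⟨hne, ?_⟩
  have hΩ : (0 : ℝ) < (UniformColoring.properFinset G k).card := by
    obtain ⟨Y, hY⟩ := hne
    exact_mod_cast Finset.card_pos.2 ⟨Y, UniformColoring.mem_properFinset.2 hY⟩
  rw [UniformColoring.uniformOn_properColorings_real, div_le_iff₀ hΩ]
  have hm : x ^ (1 - 3 / 10 * ε) ≤ 8 * x := by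
    have : x ^ (1 - 3 / 10 * ε) ≤ x ^ (1 : ℝ) :=
      Real.rpow_le_rpow_of_exponent_le hx1.le (by linarith)
    rw [Real.rpow_one] at this
    linarith
  have key := UniformColoring.card_filter_exists_bad_le (by exact_mod_cast hρ0.trans_lt hρk) hT hm
    (Nat.cast_pos.1 hx0) (UniformColoring.rpow_le_mul_exp hε hx1 hlog hk)
    (UniformColoring.threshold_bound hε hx1 hρ0 hρ h2052)
  rw [mul_left_comm, mul_comm] at key
  refine le_trans (le_of_eq (by congr!)) (key.trans ?_)
  exact mul_le_mul_of_nonneg_right (UniformColoring.card_mul_exp_le hn0 hx0 hx160) hΩ.le
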